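/- Let $d\in\{2,3\}$, let $\Omega\subset\mathbb{R}^d$ be a bounded domain with Lipschitz boundary $\Gamma=\partial\Omega$, and let $\kappa>0$ and $h_0>0$. Then there is a constant $C>0$, depending only on $d$, $\Omega$, $\kappa$ and $h_0$, with the following property. Let $S\supseteq\Omega$ be a domain, and let $\mathcal{T}_h$ be a finite conforming triangulation of $\overline{S}$ into simplices (triangles if $d=2$, tetrahedra if $d=3$), whose elements $T$ are taken to be open sets. Write $h_T$ for the diameter of $T$ and $\rho_T$ for the radius of its inscribed ball. Assume that $\mathcal{T}_h$ is shape regular, $\rho_T>h_T/\kappa$ for all $T\in\mathcal{T}_h$, and that $h=\max_{T\in\mathcal{T}_h}h_T<h_0$. Let $$\mathcal{T}_h^\Gamma=\{T\in\mathcal{T}_h:\ \mathcal{H}^{d-1}(T\cap\Gamma)>0\}$$ be the set of cut elements, where $\mathcal{H}^{d-1}$ denotes the $(d-1)$-dimensional surface (Hausdorff) measure. Then for every $T\in\mathcal{T}_h^\Gamma$, every $v\in H^1(T)$ has a trace on $T\cap\Gamma$, and $$\|v\|_{L^2(T\cap\Gamma)}\le C\left(h_T^{-1/2}\|v\|_{L^2(T)}+h_T^{1/2}\|\nabla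 v\|_{L^2(T)}\right),$$ where the left-hand side is the norm of the trace in $L^2(T\cap\Gamma,\mathcal{H}^{d-1})$. In particular, $C$ is independent of $v$, of $T$, of the mesh, and of how $\Gamma$ intersects $T$. Here a function $g\in L^2(T\cap\Gamma)$ is a trace of $v$ if there are $\varphi_k\in C^\infty(\mathbb{R}^d)$ with $\varphi_k\to v$ in $H^1(T)$ and $\varphi_k\to g$ in $L^2(T\cap\Gamma)$; the inequality holds for every trace of $v$. -/

import Mathlib

open MeasureTheory Filter Topology
open scoped ContDiff InnerProductSpace

namespace CutTrace

noncomputable section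

/-- The Euclidean space of dimension `d`. -/
abbrev Space (d : ℕ) : Type := EuclideanSpace ℝ (Fin d)

/-- A bounded domain (nonempty connected open set) with Lipschitz boundary: near each boundary point
there is a direction `n` such that the domain is the strict epigraph, in the direction `n`, of a
Lipschitz function `ψ` of the coordinates orthogonal to `n`. The point `y - ⟪n, y⟫ • n` is the
orthogonal projection of `y` to the hyperplane orthogonal to `n`, so only the values of `ψ` on
that hyperplane matter. -/
structure IsBoundedLipschitzDomain {d : ℕ} (Ω : Set (Space d)) : Prop where
  isOpen : IsOpen Ω
  isConnected : IsConnected Ω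
  isBounded : Bornology.IsBounded Ω
  locally_epigraph : ∀ x ∈ frontier Ω, ∃ r > 0, ∃ n : Space d, ‖n‖ = 1 ∧
    ∃ ψ : Space d → ℝ, (∃ L, LipschitzWith L ψ) ∧
      ∀ y ∈ Metric.ball x r, (y ∈ Ω ↔ ψ (y - ⟪n, y⟫_ℝ • n) < ⟪n, y⟫_ℝ)

/-- The elements of a mesh, as open sets: the interiors of its simplices of full dimension. -/
def elements {d : ℕ} (K : Geometry.SimplicialComplex ℝ (Space d)) : Set (Set (Space d)) :=
  {T | ∃ s ∈ K.faces, s.card = d + 1 ∧ T = interior (convexHull ℝ (s : Set (Space d)))}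

/-- `K` is an admissible (that is, conforming) triangulation of the domain `S`: a finite simplicial
complex, each of whose faces is a face of a simplex of full dimension, with the closed simplices
covering exactly the closure of `S`. -/
structure IsTriangulation {d : ℕ} (K : Geometry.SimplicialComplex ℝ (Space d))
    (S : Set (Space d)) : Prop where
  isOpen : IsOpen S
  isConnected : IsConnected S
  finite : K.faces.Finite
  pure : ∀ s ∈ K.faces, ∃ t ∈ K.faces, s ⊆ t ∧ t.card = d + 1
  space_eq : K.space = closure S

/-- The mesh size `h = max_T h_T`, where `h_T` is the diameter of `T`. -/
def meshSize {d : ℕ} (K : Geometry.SimplicialComplex ℝ (Space d)) : ℝ :=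
  sSup (Metric.diam '' elements K)

/-- The radius of the largest ball contained in `T`; for a simplex, this ball is the inscribed one. -/
def inradius {d : ℕ} (T : Set (Space d)) : ℝ :=
  sSup {r | ∃ c, Metric.ball c r ⊆ T}

/-- Shape regularity with parameter `κ`: `ρ_T > h_T / κ` for all elements `T`. -/
def IsShapeRegular {d : ℕ} (κ : ℝ) (K : Geometry.SimplicialComplex ℝ (Space d)) : Prop :=
  ∀ T ∈ elements K, Metric.diam T / κ < inradius T

/-- The surface measure: the Hausdorff measure of dimension `d - 1`, in the normalization that
agrees with the Lebesgue measure on hyperplanes. It is only used for `d = 2` and `d = 3`. -/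
def surface (d : ℕ) : Measure (Space d) :=
  Measure.euclideanHausdorffMeasure (d - 1)

/-- The elements cut by the boundary of `Ω`: those whose intersection with it has positive
surface measure. -/
def cutElements {d : ℕ} (K : Geometry.SimplicialComplex ℝ (Space d)) (Ω : Set (Space d)) :
    Set (Set (Space d)) :=
  {T | T ∈ elements K ∧ 0 < surface d (T ∩ frontier Ω)}

/-- An element of the Sobolev space `H¹(T)`: a square-integrable function on `T` together with its
square-integrable weak gradient. -/
structure H1 {d : ℕ} (T : Set (Space d)) where
  val : Space d → ℝ
  grad : Space d → Space d
  memLp_val : MemLp val 2 (volume.restrict T)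
  memLp_grad : MemLp grad 2 (volume.restrict T)
  integral_by_parts : ∀ φ : Space d → ℝ, ContDiff ℝ ∞ φ → HasCompactSupport φ → tsupport φ ⊆ T →
    ∀ e : Space d, ∫ x in T, val x * fderiv ℝ φ x e = - ∫ x in T, ⟪grad x, e⟫_ℝ * φ x

/-- The norm of `L²(A, μ)`, as a real number, meant for `f` in that space. -/
def normL2 {d : ℕ} {F : Type*} [NormedAddCommGroup F] (μ : Measure (Space d)) (A : Set (Space d))
    (f : Space d → F) : ℝ :=
  (eLpNorm f 2 (μ.restrict A)).toReal

/-- `g` is the trace of `v ∈ H¹(T)` on the part `A` of a hypersurface: `g ∈ L²(A)`, and there are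
functions in `C^∞(ℝ^d)` which converge to `v` in `H¹(T)` while their restrictions
to `A` converge to `g` in `L²(A)`. In other words, the trace operator is the closure of the
restriction of smooth functions. -/
def IsTrace {d : ℕ} {T : Set (Space d)} (v : H1 T) (A : Set (Space d)) (g : Space d → ℝ) : Prop :=
  MemLp g 2 ((surface d).restrict A) ∧
  ∃ φ : ℕ → Space d → ℝ, (∀ k, ContDiff ℝ ∞ (φ k)) ∧
    Tendsto (fun k => eLpNorm (φ k - v.val) 2 (volume.restrict T)) atTop (𝓝 0) ∧
    Tendsto (fun k => eLpNorm (gradient (φ k) - v.grad) 2 (volume.restrict T)) atTop (𝓝 0) ∧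
    Tendsto (fun k => eLpNorm (φ k - g) 2 ((surface d).restrict A)) atTop (𝓝 0)

end

end CutTrace

/-! ### Surface measure of a Lipschitz boundary in balls -/

namespace CutTrace

/-! The only fact about `Γ` that matters is upper Ahlfors regularity: a ball of radius `r` carries
at most `A * r ^ (d - 1)` of its surface measure, with `A` depending on `Ω` alone. Locally `Γ` is a
Lipschitz graph, and it is compact (`exists_surface_frontier_inter_closedBall_le`). How `Γ` cuts `T`
is then irrelevant.

For smooth `φ`, `x ∈ T ∩ Γ` and `y ∈ T`, write `φ x` as `φ y` plus the integral of the derivative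
along the segment, square, and integrate over `x` and `y`. At the point `z = x + t • (y - x)` the
substitution `y ↦ z` costs `t ^ (-d)`, while `x` stays within `t * h` of `z` and so ranges over
surface measure at most `A * (t * h) ^ (d - 1)`. The product is of order `t⁻¹`, which just fails to
be integrable; the parametrization `t = s ^ 2` makes Cauchy–Schwarz supply the missing weight. This
bounds `|T| ‖φ‖²` on `T ∩ Γ` (`lintegral_sq_le_of_convex`), and shape regularity gives `|T| ≥ c * h
^ d` (`exists_eLpNorm_le_of_convex`).

To reach `H¹`, smooth functions on the whole space are shown to be dense. Ordinary mollification
would need values outside `T`; averaging over contractions `x ↦ (1 - s) • x + s • y` towards points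
`y ∈ T` uses only values in `T`, by convexity (`exists_contDiff_tendsto_H1`). The inequality applied
to differences makes the restrictions Cauchy (`exists_isTrace_and_eLpNorm_le`). -/

theorem norm_sub_inner_smul_le {E : Type*} [NormedAddCommGroup E] [InnerProductSpace ℝ E]
    {n : E} (hn : ‖n‖ = 1) (w : E) : ‖w - ⟪n, w⟫_ℝ • n‖ ≤ ‖w‖ := by
  have h : ‖w - ⟪n, w⟫_ℝ • n‖ ^ 2 = ‖w‖ ^ 2 - ⟪n, w⟫_ℝ ^ 2 := by
    rw [norm_sub_sq_real, inner_smul_right, real_inner_comm, norm_smul, hn]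
    simp only [Real.norm_eq_abs, mul_one, sq_abs]
    ring
  exact le_of_sq_le_sq (by nlinarith [sq_nonneg ⟪n, w⟫_ℝ]) (norm_nonneg _)

/-- The graph of a Lipschitz function over a hyperplane is upper Ahlfors regular. -/
theorem exists_hausdorffMeasure_graph_inter_closedBall_le {d : ℕ} {n : Space d} (hn : ‖n‖ = 1)
    {ψ : Space d → ℝ} {L : NNReal} (hψ : LipschitzWith L ψ) :
    ∃ A : NNReal, ∀ (z : Space d) (r : ℝ), 0 ≤ r →
      surface d ({y | ⟪n, y⟫_ℝ = ψ (y - ⟪n, y⟫_ℝ • n)} ∩ Metric.closedBall z r) ≤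
        A * ENNReal.ofReal (r ^ (d - 1)) := by
  set m := d - 1 with hm
  have hd : d = m + 1 := by
    rcases d with _ | d
    · exfalso
      have : n = 0 := Subsingleton.elim _ _
      simp [this] at hn
    · simp [hm]
  have hfr : Module.finrank ℝ (ℝ ∙ n)ᗮ = m := by
    have : Fact (Module.finrank ℝ (Space d) = m + 1) := ⟨by simp [hd]⟩
    exact Submodule.finrank_orthogonal_span_singleton (by rintro rfl; simp at hn)
  let e : (ℝ ∙ n)ᗮ ≃ₗᵢ[ℝ] EuclideanSpace ℝ (Fin m) :=
    ((stdOrthonormalBasis ℝ (ℝ ∙ n)ᗮ).reindex (finCongr hfr)).repr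
  let G : EuclideanSpace ℝ (Fin m) → Space d := fun p =>
    (e.symm p : Space d) + ψ (e.symm p : Space d) • n
  have he : LipschitzWith 1 (fun p => (e.symm p : Space d)) := by
    have h := (isometry_subtype_coe (s := ((ℝ ∙ n)ᗮ : Set (Space d)))).comp e.symm.isometry
    exact h.lipschitz
  have hG : LipschitzWith (1 + L) G := by
    refine he.add ?_
    have h1 : LipschitzWith L (fun p => ψ (e.symm p : Space d)) := by
      have h := hψ.comp he
      rw [mul_one] at h
      exact h
    refine LipschitzWith.of_dist_le_mul fun p q => ?_
    rw [dist_eq_norm, ← sub_smul, norm_smul, hn, mul_one, ← dist_eq_norm]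
    exact h1.dist_le_mul p q
  have hmem : ∀ y : Space d, y - ⟪n, y⟫_ℝ • n ∈ (ℝ ∙ n)ᗮ := fun y => by
    rw [Submodule.mem_orthogonal_singleton_iff_inner_right, inner_sub_right, inner_smul_right,
      real_inner_self_eq_norm_sq, hn]
    ring
  set V : ENNReal := volume (Metric.ball (0 : EuclideanSpace ℝ (Fin m)) 1) with hV
  have hVfin : V ≠ ⊤ := measure_ball_lt_top.ne
  refine ⟨(1 + L) ^ m * V.toNNReal, fun z r hr => ?_⟩
  -- Projection to the hyperplane does not increase distances, so the part of the graph in a ball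
  -- lies over a ball of the same radius.
  have hsub : {y | ⟪n, y⟫_ℝ = ψ (y - ⟪n, y⟫_ℝ • n)} ∩ Metric.closedBall z r ⊆
      G '' Metric.closedBall (e ⟨_, hmem z⟩) r := by
    rintro y ⟨hy, hyz⟩
    refine ⟨e ⟨_, hmem y⟩, ?_, ?_⟩
    · rw [Metric.mem_closedBall, e.dist_map, Subtype.dist_eq, dist_eq_norm]
      rw [Metric.mem_closedBall, dist_eq_norm] at hyz
      refine le_trans (le_of_eq ?_) ((norm_sub_inner_smul_le hn (y - z)).trans hyz)
      rw [inner_sub_right, sub_smul]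
      congr 1
      simp only
      abel
    · have hy' : ⟪n, y⟫_ℝ = ψ (y - ⟪n, y⟫_ℝ • n) := hy
      simp only [G, LinearIsometryEquiv.symm_apply_apply]
      rw [← hy']
      abel
  have himg : surface d (G '' Metric.closedBall (e ⟨_, hmem z⟩) r) ≤
      ((1 + L : NNReal) : ENNReal) ^ m * volume (Metric.closedBall (e ⟨_, hmem z⟩) r) := by
    rw [← EuclideanSpace.euclideanHausdorffMeasure_eq_volume, surface,
      Measure.euclideanHausdorffMeasure_def, Measure.euclideanHausdorffMeasure_def,
      Measure.smul_apply, Measure.smul_apply, ← hm]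
    have h := hG.hausdorffMeasure_image_le (d := (m : ℝ)) (by positivity)
      (Metric.closedBall (e ⟨_, hmem z⟩) r)
    rw [ENNReal.rpow_natCast] at h
    -- The normalizing factor depends on `m` only, so it is the same in both spaces and cancels.
    rw [ENNReal.smul_def, smul_eq_mul, ENNReal.smul_def, smul_eq_mul, mul_left_comm]
    gcongr
  refine (measure_mono hsub).trans (himg.trans (le_of_eq ?_))
  rw [Measure.addHaar_closedBall _ _ hr, finrank_euclideanSpace_fin, ← hV]
  push_cast
  rw [ENNReal.coe_toNNReal hVfin]
  ring

/-- The boundary of a bounded Lipschitz domain is upper Ahlfors regular. -/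
theorem IsBoundedLipschitzDomain.exists_surface_frontier_inter_closedBall_le {d : ℕ}
    {Ω : Set (Space d)} (hΩ : IsBoundedLipschitzDomain Ω) :
    ∃ A : NNReal, ∀ (z : Space d) (r : ℝ), 0 ≤ r →
      surface d (frontier Ω ∩ Metric.closedBall z r) ≤ A * ENNReal.ofReal (r ^ (d - 1)) := by
  have hloc : ∀ x ∈ frontier Ω, ∃ U ∈ 𝓝 x, ∃ A : NNReal, ∀ (z : Space d) (r : ℝ), 0 ≤ r →
      surface d (frontier Ω ∩ U ∩ Metric.closedBall z r) ≤ A * ENNReal.ofReal (r ^ (d - 1)) := by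
    intro x hx
    obtain ⟨ρ, hρ, n, hn, ψ, ⟨L, hψ⟩, hΩψ⟩ := hΩ.locally_epigraph x hx
    obtain ⟨A, hA⟩ := exists_hausdorffMeasure_graph_inter_closedBall_le hn hψ
    refine ⟨Metric.ball x ρ, Metric.ball_mem_nhds x hρ, A, fun z r hr => ?_⟩
    refine (measure_mono ?_).trans (hA z r hr)
    refine Set.inter_subset_inter_left _ ?_
    rintro y ⟨hy, hyx⟩
    have hcont : Continuous fun y : Space d => ψ (y - ⟪n, y⟫_ℝ • n) :=
      hψ.continuous.comp (by fun_prop)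
    have hinn : Continuous fun y : Space d => ⟪n, y⟫_ℝ := by fun_prop
    have hyΩ : y ∉ Ω := by
      rw [hΩ.isOpen.frontier_eq] at hy
      exact hy.2
    have h1 : ⟪n, y⟫_ℝ ≤ ψ (y - ⟪n, y⟫_ℝ • n) := by
      rw [hΩψ y hyx] at hyΩ
      exact not_lt.mp hyΩ
    refine le_antisymm h1 ?_
    -- The opposite inequality is a closed condition, inherited from points of `Ω` in the ball that
    -- converge to `y`.
    have hycl : y ∈ closure (Ω ∩ Metric.ball x ρ) := by
      rw [Set.inter_comm]
      exact Metric.isOpen_ball.inter_closure ⟨hyx, frontier_subset_closure hy⟩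
    refine closure_minimal ?_ (isClosed_le hcont hinn) hycl
    rintro w ⟨hw, hwx⟩
    exact ((hΩψ w hwx).1 hw).le
  have hcpt : IsCompact (frontier Ω) :=
    Metric.isCompact_of_isClosed_isBounded isClosed_frontier
      (hΩ.isBounded.closure.subset frontier_subset_closure)
  choose! U hU A hA using hloc
  obtain ⟨t, ht, htU⟩ := hcpt.elim_nhds_subcover U hU
  refine ⟨∑ x ∈ t, A x, fun z r hr => ?_⟩
  calc surface d (frontier Ω ∩ Metric.closedBall z r)
      ≤ surface d (⋃ x ∈ t, frontier Ω ∩ U x ∩ Metric.closedBall z r) := by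
        refine measure_mono ?_
        rintro y ⟨hy, hyz⟩
        obtain ⟨x, hx, hyx⟩ := Set.mem_iUnion₂.1 (htU hy)
        exact Set.mem_iUnion₂.2 ⟨x, hx, ⟨hy, hyx⟩, hyz⟩
    _ ≤ ∑ x ∈ t, surface d (frontier Ω ∩ U x ∩ Metric.closedBall z r) :=
        measure_biUnion_finset_le _ _
    _ ≤ ∑ x ∈ t, A x * ENNReal.ofReal (r ^ (d - 1)) :=
        Finset.sum_le_sum fun x hx => hA x (ht x hx) z r hr
    _ = _ := by rw [← Finset.sum_mul]; push_cast; rfl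

end CutTrace

/-! ### The trace inequality for smooth functions -/

namespace CutTrace

/-- Cauchy–Schwarz against the constant 1. It serves both Lebesgue measure on `[0, 1]` and
probability measures. -/
theorem sq_lintegral_le_lintegral_sq {α : Type*} [MeasurableSpace α] {ν : Measure α}
    (hν : ν Set.univ ≤ 1) {F : α → ENNReal} (hF : AEMeasurable F ν) :
    (∫⁻ a, F a ∂ν) ^ 2 ≤ ∫⁻ a, F a ^ 2 ∂ν := by
  have h := ENNReal.lintegral_mul_le_Lp_mul_Lq ν Real.HolderConjugate.two_two hF
    (aemeasurable_const (b := (1 : ENNReal)))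
  simp only [Pi.mul_apply, mul_one, ENNReal.one_rpow, lintegral_const, one_mul] at h
  have h1 : ∫⁻ a, F a ∂ν ≤ (∫⁻ a, F a ^ (2 : ℝ) ∂ν) ^ (1 / 2 : ℝ) :=
    h.trans (mul_le_of_le_one_right' (ENNReal.rpow_le_one hν (by norm_num)))
  calc (∫⁻ a, F a ∂ν) ^ 2 ≤ ((∫⁻ a, F a ^ (2 : ℝ) ∂ν) ^ (1 / 2 : ℝ)) ^ 2 := by gcongr
    _ = ∫⁻ a, F a ^ 2 ∂ν := by
      rw [← ENNReal.rpow_natCast, ← ENNReal.rpow_mul]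
      norm_num

theorem ennreal_add_sq_le (a b : ENNReal) : (a + b) ^ 2 ≤ 2 * a ^ 2 + 2 * b ^ 2 := by
  have h := ENNReal.rpow_add_le_mul_rpow_add_rpow a b (p := 2) (by norm_num)
  norm_num at h
  rwa [mul_add] at h

theorem lintegral_comp_smul_add {E : Type*} [NormedAddCommGroup E] [NormedSpace ℝ E]
    [MeasurableSpace E] [BorelSpace E] [FiniteDimensional ℝ E] (μ : Measure E) [μ.IsAddHaarMeasure]
    {F : E → ENNReal} (hF : Measurable F) {c : ℝ} (hc : 0 < c) (b : E) :
    ∫⁻ y, F (c • y + b) ∂μ = ENNReal.ofReal ((c ^ Module.finrank ℝ E)⁻¹) * ∫⁻ z, F z ∂μ := by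
  calc ∫⁻ y, F (c • y + b) ∂μ = ∫⁻ z, F (z + b) ∂(Measure.map (c • ·) μ) := by
        rw [lintegral_map (f := fun z => F (z + b)) (hF.comp (measurable_add_const b))
          (measurable_const_smul c)]
    _ = _ := by
        rw [Measure.map_addHaar_smul μ hc.ne', lintegral_smul_measure,
          lintegral_add_right_eq_self (fun z => F z) b, abs_of_pos (by positivity), smul_eq_mul]

/-- The quadratic parametrization has speed `2 * s * ‖y - x‖`, and Cauchy–Schwarz turns the factor
`s` into the weight `s ^ 2`. This weight offsets the concentration of the segments near `x`. -/
theorem enorm_sub_sq_le_lintegral {E : Type*} [NormedAddCommGroup E] [NormedSpace ℝ E]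
    {φ : E → ℝ} (hφ : ContDiff ℝ 1 φ) {x y : E} {h : ℝ} (hxy : dist x y ≤ h) :
    ‖φ x - φ y‖ₑ ^ 2 ≤ ENNReal.ofReal (4 * h ^ 2) *
      ∫⁻ s in Set.Icc (0 : ℝ) 1, ENNReal.ofReal (s ^ 2) * ‖fderiv ℝ φ (x + s ^ 2 • (y - x))‖ₑ ^ 2 := by
  have hh : 0 ≤ h := dist_nonneg.trans hxy
  set γ : ℝ → ℝ := fun s => φ (x + s ^ 2 • (y - x)) with hγ
  have hγd : ∀ s, HasDerivAt γ (fderiv ℝ φ (x + s ^ 2 • (y - x)) ((2 * s) • (y - x))) s := by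
    intro s
    have h1 : HasDerivAt (fun s : ℝ => x + s ^ 2 • (y - x)) ((2 * s) • (y - x)) s := by
      have h2 : HasDerivAt (fun s : ℝ => s ^ 2) (2 * s) s := by simpa using hasDerivAt_pow 2 s
      exact (h2.smul_const (y - x)).const_add x
    exact ((hφ.differentiable one_ne_zero).differentiableAt.hasFDerivAt).comp_hasDerivAt s h1
  have hγc : ContDiff ℝ 1 γ := by fun_prop
  have h01 := enorm_sub_le_lintegral_deriv_of_contDiffOn_Icc (hγc.contDiffOn (s := Set.Icc 0 1))
    zero_le_one
  have hcont : Continuous fun s : ℝ => fderiv ℝ φ (x + s ^ 2 • (y - x)) :=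
    (hφ.continuous_fderiv one_ne_zero).comp (by fun_prop)
  have hle : ‖φ x - φ y‖ₑ ≤ ∫⁻ s in Set.Icc (0 : ℝ) 1,
      ENNReal.ofReal (2 * h) * (ENNReal.ofReal s * ‖fderiv ℝ φ (x + s ^ 2 • (y - x))‖ₑ) := by
    calc ‖φ x - φ y‖ₑ = ‖γ 1 - γ 0‖ₑ := by
          rw [← enorm_neg]
          simp [hγ]
      _ ≤ _ := h01
      _ ≤ _ := by
        refine setLIntegral_mono' measurableSet_Icc fun s hs => ?_
        rw [(hγd s).deriv]
        refine (ContinuousLinearMap.le_opENorm _ _).trans ?_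
        have h3 : ‖(2 * s) • (y - x)‖ₑ ≤ ENNReal.ofReal (2 * h) * ENNReal.ofReal s := by
          rw [← ENNReal.ofReal_mul (by positivity), ← ofReal_norm, norm_smul,
            Real.norm_of_nonneg (by linarith [hs.1])]
          rw [dist_comm, dist_eq_norm] at hxy
          refine ENNReal.ofReal_le_ofReal ?_
          nlinarith [mul_le_mul_of_nonneg_left hxy hs.1]
        calc _ ≤ ‖fderiv ℝ φ (x + s ^ 2 • (y - x))‖ₑ *
              (ENNReal.ofReal (2 * h) * ENNReal.ofReal s) := by gcongr
          _ = _ := by ring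
  calc ‖φ x - φ y‖ₑ ^ 2 ≤ (∫⁻ s in Set.Icc (0 : ℝ) 1, ENNReal.ofReal (2 * h) *
        (ENNReal.ofReal s * ‖fderiv ℝ φ (x + s ^ 2 • (y - x))‖ₑ)) ^ 2 := by gcongr
    _ ≤ ∫⁻ s in Set.Icc (0 : ℝ) 1, (ENNReal.ofReal (2 * h) *
        (ENNReal.ofReal s * ‖fderiv ℝ φ (x + s ^ 2 • (y - x))‖ₑ)) ^ 2 := by
      refine sq_lintegral_le_lintegral_sq (by simp) (Measurable.aemeasurable ?_)
      exact ((ENNReal.measurable_ofReal).mul hcont.measurable.enorm).const_mul _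
    _ = _ := by
      rw [← lintegral_const_mul' _ _ ENNReal.ofReal_ne_top]
      refine setLIntegral_congr_fun measurableSet_Icc fun s hs => ?_
      rw [mul_pow, mul_pow, ENNReal.ofReal_pow hs.1, ← ENNReal.ofReal_pow (by positivity)]
      ring_nf

/-- Averaging the square of a function along rays which emanate from the support of an upper
Ahlfors regular measure. -/
theorem lintegral_lintegral_comp_segment_le {d : ℕ} {T : Set (Space d)} (hTc : Convex ℝ T)
    (hTo : IsOpen T) {h : ℝ} (hdiam : ∀ x ∈ T, ∀ y ∈ T, dist x y ≤ h) (hh : 0 < h)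
    {μ : Measure (Space d)} [SFinite μ] {A : NNReal}
    (hμ : ∀ z r, 0 ≤ r → μ (Metric.closedBall z r) ≤ A * ENNReal.ofReal (r ^ (d - 1)))
    (hd : 1 ≤ d) {g : Space d → ENNReal} (hg : Measurable g) {s : ℝ} (hs : 0 < s) (hs1 : s ≤ 1) :
    ENNReal.ofReal (s ^ 2) * ∫⁻ x in T, ∫⁻ y in T, g (x + s ^ 2 • (y - x)) ∂volume ∂μ ≤
      A * ENNReal.ofReal (h ^ (d - 1)) * ∫⁻ z in T, g z := by
  have hTm := hTo.measurableSet
  have hin : ∀ x ∈ T, ∫⁻ y in T, g (x + s ^ 2 • (y - x)) ≤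
      ENNReal.ofReal (((s ^ 2) ^ d)⁻¹) *
        ∫⁻ z in T, (Metric.closedBall z (s ^ 2 * h)).indicator 1 x * g z := by
    intro x hx
    -- The two indicators record what is known of `z = x + s ^ 2 • (y - x)`: it lies in `T` by
    -- convexity, and within `s ^ 2 * h` of `x`. After Tonelli the second confines `x` to a small
    -- ball about `z`.
    set F : Space d → ENNReal := T.indicator ((Metric.closedBall x (s ^ 2 * h)).indicator g) with hF
    have hFm : Measurable F := (hg.indicator measurableSet_closedBall).indicator hTm
    have hpt : ∀ y ∈ T, g (x + s ^ 2 • (y - x)) ≤ F (s ^ 2 • y + (1 - s ^ 2) • x) := by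
      intro y hy
      have hs2 : s ^ 2 ≤ 1 := pow_le_one₀ hs.le hs1
      have he : x + s ^ 2 • (y - x) = s ^ 2 • y + (1 - s ^ 2) • x := by module
      have h1 : s ^ 2 • y + (1 - s ^ 2) • x ∈ T :=
        hTc hy hx (by positivity) (by linarith) (by ring)
      have h2 : s ^ 2 • y + (1 - s ^ 2) • x ∈ Metric.closedBall x (s ^ 2 * h) := by
        rw [← he, Metric.mem_closedBall, dist_eq_norm, add_sub_cancel_left, norm_smul,
          Real.norm_of_nonneg (by positivity), ← dist_eq_norm]
        gcongr
        exact hdiam y hy x hx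
      rw [hF, Set.indicator_of_mem h1, Set.indicator_of_mem h2, he]
    calc ∫⁻ y in T, g (x + s ^ 2 • (y - x))
        ≤ ∫⁻ y in T, F (s ^ 2 • y + (1 - s ^ 2) • x) := setLIntegral_mono' hTm hpt
      _ ≤ ∫⁻ y, F (s ^ 2 • y + (1 - s ^ 2) • x) := setLIntegral_le_lintegral _ _
      _ = ENNReal.ofReal (((s ^ 2) ^ d)⁻¹) * ∫⁻ z, F z := by
        rw [lintegral_comp_smul_add volume hFm (by positivity), finrank_euclideanSpace_fin]
      _ = _ := by
        rw [hF, lintegral_indicator hTm]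
        congr 1
        refine lintegral_congr fun z => ?_
        by_cases hz : z ∈ Metric.closedBall x (s ^ 2 * h)
        · rw [Set.indicator_of_mem hz, Set.indicator_of_mem (Metric.mem_closedBall_comm.1 hz)]
          simp
        · rw [Set.indicator_of_notMem hz,
            Set.indicator_of_notMem (fun h => hz (Metric.mem_closedBall_comm.1 h)), zero_mul]
  have hmeas : Measurable (Function.uncurry fun x z : Space d =>
      (Metric.closedBall z (s ^ 2 * h)).indicator (1 : Space d → ENNReal) x * g z) := by
    refine Measurable.mul ?_ (hg.comp measurable_snd)
    have hset : MeasurableSet {p : Space d × Space d | dist p.1 p.2 ≤ s ^ 2 * h} :=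
      (isClosed_le (by fun_prop) (by fun_prop)).measurableSet
    have : Measurable ({p : Space d × Space d | dist p.1 p.2 ≤ s ^ 2 * h}.indicator
      (fun _ => (1 : ENNReal))) := measurable_const.indicator hset
    exact this
  calc ENNReal.ofReal (s ^ 2) * ∫⁻ x in T, ∫⁻ y in T, g (x + s ^ 2 • (y - x)) ∂volume ∂μ
      ≤ ENNReal.ofReal (s ^ 2) * ∫⁻ x in T, ENNReal.ofReal (((s ^ 2) ^ d)⁻¹) *
        (∫⁻ z in T, (Metric.closedBall z (s ^ 2 * h)).indicator 1 x * g z) ∂μ := by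
        gcongr 1
        exact setLIntegral_mono' hTm hin
    _ = ENNReal.ofReal (s ^ 2) * (ENNReal.ofReal (((s ^ 2) ^ d)⁻¹) *
        ∫⁻ z in T, (∫⁻ x in T, (Metric.closedBall z (s ^ 2 * h)).indicator 1 x ∂μ) * g z) := by
        rw [lintegral_const_mul' _ _ ENNReal.ofReal_ne_top,
          lintegral_lintegral_swap hmeas.aemeasurable]
        congr 2
        refine lintegral_congr fun z => ?_
        rw [lintegral_mul_const _ (measurable_one.indicator measurableSet_closedBall)]
    _ ≤ ENNReal.ofReal (s ^ 2) * (ENNReal.ofReal (((s ^ 2) ^ d)⁻¹) *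
        ∫⁻ z in T, (A * ENNReal.ofReal ((s ^ 2 * h) ^ (d - 1))) * g z) := by
        gcongr with z
        rw [lintegral_indicator_one measurableSet_closedBall]
        exact (Measure.restrict_apply_le _ _).trans (hμ z _ (by positivity))
    _ = (ENNReal.ofReal (s ^ 2) * ENNReal.ofReal (((s ^ 2) ^ d)⁻¹) *
          ENNReal.ofReal ((s ^ 2 * h) ^ (d - 1))) * (A * ∫⁻ z in T, g z) := by
        rw [lintegral_const_mul' _ _ (by finiteness)]
        ring
    _ = _ := by
        rw [← ENNReal.ofReal_mul (by positivity), ← ENNReal.ofReal_mul (by positivity)]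
        -- Weight, Jacobian and Ahlfors bound cancel exactly in `s`, so the bound is uniform on `(0,
        -- 1]`.
        have : s ^ 2 * ((s ^ 2) ^ d)⁻¹ * (s ^ 2 * h) ^ (d - 1) = h ^ (d - 1) := by
          obtain ⟨m, rfl⟩ : ∃ m, d = m + 1 := ⟨d - 1, by omega⟩
          simp only [Nat.add_sub_cancel]
          field_simp
          ring
        rw [this]
        ring

/-- The trace inequality for smooth functions on a convex open set, for an upper Ahlfors regular
measure. -/
theorem lintegral_sq_le_of_convex {d : ℕ} {T : Set (Space d)} (hTc : Convex ℝ T)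
    (hTo : IsOpen T) {h : ℝ} (hdiam : ∀ x ∈ T, ∀ y ∈ T, dist x y ≤ h) (hh : 0 < h)
    {μ : Measure (Space d)} [SFinite μ] {A : NNReal}
    (hμ : ∀ z r, 0 ≤ r → μ (Metric.closedBall z r) ≤ A * ENNReal.ofReal (r ^ (d - 1)))
    (hd : 1 ≤ d) {φ : Space d → ℝ} (hφ : ContDiff ℝ 1 φ) :
    volume T * ∫⁻ x in T, ‖φ x‖ₑ ^ 2 ∂μ ≤
      2 * A * ENNReal.ofReal (h ^ (d - 1)) * (∫⁻ y in T, ‖φ y‖ₑ ^ 2) +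
      8 * A * ENNReal.ofReal (h ^ (d + 1)) * ∫⁻ y in T, ‖fderiv ℝ φ y‖ₑ ^ 2 := by
  have hTm := hTo.measurableSet
  rcases T.eq_empty_or_nonempty with rfl | ⟨x₀, hx₀⟩
  · simp
  have hμT : μ T ≤ A * ENNReal.ofReal (h ^ (d - 1)) :=
    (measure_mono fun y hy => hdiam y hy x₀ hx₀).trans (hμ x₀ h hh.le)
  set g : Space d → ENNReal := fun z => ‖fderiv ℝ φ z‖ₑ ^ 2 with hg
  have hgc : Continuous (fderiv ℝ φ) := hφ.continuous_fderiv one_ne_zero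
  have hgm : Measurable g := hgc.measurable.enorm.pow_const 2
  have hφm : Measurable φ := hφ.continuous.measurable
  set c : ENNReal := ENNReal.ofReal (4 * h ^ 2) with hc
  have hGm : Measurable fun p : (Space d × Space d) × ℝ =>
      ENNReal.ofReal (p.2 ^ 2) * g (p.1.1 + p.2 ^ 2 • (p.1.2 - p.1.1)) := by
    refine Measurable.mul ?_ (hgm.comp ?_)
    · exact ENNReal.measurable_ofReal.comp (by fun_prop)
    · exact Continuous.measurable (by fun_prop)
  have hpt : ∀ x ∈ T, ∀ y ∈ T, ‖φ x‖ₑ ^ 2 ≤ 2 * ‖φ y‖ₑ ^ 2 + 2 * c *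
      ∫⁻ s in Set.Icc (0 : ℝ) 1, ENNReal.ofReal (s ^ 2) * g (x + s ^ 2 • (y - x)) := by
    intro x hx y hy
    calc ‖φ x‖ₑ ^ 2 = ‖φ y + (φ x - φ y)‖ₑ ^ 2 := by rw [add_sub_cancel]
      _ ≤ (‖φ y‖ₑ + ‖φ x - φ y‖ₑ) ^ 2 := by gcongr; exact enorm_add_le _ _
      _ ≤ 2 * ‖φ y‖ₑ ^ 2 + 2 * ‖φ x - φ y‖ₑ ^ 2 := ennreal_add_sq_le _ _
      _ ≤ _ := by
        rw [mul_assoc 2 c]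
        gcongr
        exact enorm_sub_sq_le_lintegral hφ (hdiam x hx y hy)
  have hdouble : ∫⁻ x in T, ∫⁻ y in T, (∫⁻ s in Set.Icc (0 : ℝ) 1,
      ENNReal.ofReal (s ^ 2) * g (x + s ^ 2 • (y - x))) ∂volume ∂μ ≤
      A * ENNReal.ofReal (h ^ (d - 1)) * ∫⁻ z in T, g z := by
    calc ∫⁻ x in T, ∫⁻ y in T, (∫⁻ s in Set.Icc (0 : ℝ) 1,
          ENNReal.ofReal (s ^ 2) * g (x + s ^ 2 • (y - x))) ∂volume ∂μ
        = ∫⁻ x in T, ∫⁻ s in Set.Icc (0 : ℝ) 1, ∫⁻ y in T,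
          ENNReal.ofReal (s ^ 2) * g (x + s ^ 2 • (y - x)) ∂volume ∂volume ∂μ := by
          refine lintegral_congr fun x => ?_
          rw [lintegral_lintegral_swap]
          exact (hGm.comp (f := fun p : Space d × ℝ => ((x, p.1), p.2))
            (by fun_prop)).aemeasurable
      _ = ∫⁻ s in Set.Icc (0 : ℝ) 1, ∫⁻ x in T, ∫⁻ y in T,
          ENNReal.ofReal (s ^ 2) * g (x + s ^ 2 • (y - x)) ∂volume ∂μ := by
          rw [lintegral_lintegral_swap]
          refine Measurable.aemeasurable ?_
          exact Measurable.lintegral_prod_right' (ν := volume.restrict T)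
            (f := fun q : (Space d × ℝ) × Space d =>
              ENNReal.ofReal (q.1.2 ^ 2) * g (q.1.1 + q.1.2 ^ 2 • (q.2 - q.1.1)))
            (hGm.comp (f := fun q : (Space d × ℝ) × Space d => ((q.1.1, q.2), q.1.2))
              (by fun_prop))
      _ ≤ ∫⁻ s in Set.Icc (0 : ℝ) 1, A * ENNReal.ofReal (h ^ (d - 1)) * ∫⁻ z in T, g z := by
          -- The estimate for fixed `s` needs `0 < s`; the endpoint is a null set.
          rw [← restrict_Ioc_eq_restrict_Icc]
          refine setLIntegral_mono' measurableSet_Ioc fun s hs => ?_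
          simp_rw [lintegral_const_mul' _ _ ENNReal.ofReal_ne_top]
          exact lintegral_lintegral_comp_segment_le hTc hTo hdiam hh hμ hd hgm hs.1 hs.2
      _ = _ := by simp
  have hc0 : 2 * c ≠ ⊤ := by finiteness
  calc volume T * ∫⁻ x in T, ‖φ x‖ₑ ^ 2 ∂μ
      = ∫⁻ x in T, ∫⁻ y in T, ‖φ x‖ₑ ^ 2 ∂volume ∂μ := by
        simp_rw [setLIntegral_const]
        rw [lintegral_mul_const _ (hφm.enorm.pow_const 2), mul_comm]
    _ ≤ ∫⁻ x in T, ∫⁻ y in T, (2 * ‖φ y‖ₑ ^ 2 + 2 * c * ∫⁻ s in Set.Icc (0 : ℝ) 1,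
          ENNReal.ofReal (s ^ 2) * g (x + s ^ 2 • (y - x))) ∂volume ∂μ :=
        setLIntegral_mono' hTm fun x hx => setLIntegral_mono' hTm fun y hy => hpt x hx y hy
    _ = μ T * (2 * ∫⁻ y in T, ‖φ y‖ₑ ^ 2) + 2 * c * ∫⁻ x in T, ∫⁻ y in T,
          (∫⁻ s in Set.Icc (0 : ℝ) 1,
            ENNReal.ofReal (s ^ 2) * g (x + s ^ 2 • (y - x))) ∂volume ∂μ := by
        simp_rw [lintegral_add_left ((hφm.enorm.pow_const 2).const_mul 2),
          lintegral_const_mul' _ _ hc0, lintegral_const_mul' _ _ ENNReal.ofNat_ne_top]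
        rw [lintegral_add_left measurable_const, setLIntegral_const,
          lintegral_const_mul' _ _ hc0]
        ring
    _ ≤ (A * ENNReal.ofReal (h ^ (d - 1))) * (2 * ∫⁻ y in T, ‖φ y‖ₑ ^ 2) + 2 * c *
          (A * ENNReal.ofReal (h ^ (d - 1)) * ∫⁻ z in T, g z) := by gcongr
    _ = _ := by
        have h4 : c * ENNReal.ofReal (h ^ (d - 1)) = 4 * ENNReal.ofReal (h ^ (d + 1)) := by
          rw [hc, ← ENNReal.ofReal_mul (by positivity),
            show (4 : ENNReal) = ENNReal.ofReal 4 by simp, ← ENNReal.ofReal_mul (by positivity)]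
          obtain ⟨m, rfl⟩ : ∃ m, d = m + 1 := ⟨d - 1, by omega⟩
          simp only [Nat.add_sub_cancel]
          ring_nf
        calc _ = 2 * A * ENNReal.ofReal (h ^ (d - 1)) * (∫⁻ y in T, ‖φ y‖ₑ ^ 2) +
              2 * A * (c * ENNReal.ofReal (h ^ (d - 1))) * ∫⁻ z in T, g z := by ring
          _ = _ := by rw [h4]; ring

end CutTrace

/-! ### Convergence in L² of means over contractions -/

namespace CutTrace

theorem eLpNorm_two_sq {α F : Type*} [MeasurableSpace α] [NormedAddCommGroup F] (f : α → F)
    (μ : Measure α) : eLpNorm f 2 μ ^ 2 = ∫⁻ x, ‖f x‖ₑ ^ 2 ∂μ := by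
  rw [eLpNorm_eq_lintegral_rpow_enorm_toReal two_ne_zero ENNReal.ofNat_ne_top,
    ← ENNReal.rpow_natCast, ← ENNReal.rpow_mul]
  norm_num

/-- The mean of `f`, with respect to `ν`, over the contraction of the space to the point `x` with
ratio `s`. -/
noncomputable def contractionMean {d : ℕ} {F : Type*} [NormedAddCommGroup F] [NormedSpace ℝ F]
    (ν : Measure (Space d)) (s : ℝ) (f : Space d → F) (x : Space d) : F :=
  ∫ y, f ((1 - s) • x + s • y) ∂ν

variable {d : ℕ} {F : Type*} [NormedAddCommGroup F]

theorem eLpNorm_comp_contraction_le {f : Space d → F} (hf : StronglyMeasurable f) {s : ℝ}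
    (hs1 : s ≤ 1 / 2) (y : Space d) :
    eLpNorm (fun x => f ((1 - s) • x + s • y)) 2 volume ≤ 2 ^ d * eLpNorm f 2 volume := by
  have h := lintegral_comp_smul_add (volume : Measure (Space d)) (hf.enorm.pow_const 2)
    (c := 1 - s) (by linarith) (s • y)
  have hle : ENNReal.ofReal (((1 - s) ^ Module.finrank ℝ (Space d))⁻¹) ≤ 2 ^ d := by
    rw [finrank_euclideanSpace_fin, ← inv_pow,
      show (2 : ENNReal) = ENNReal.ofReal 2 by simp, ← ENNReal.ofReal_pow (by norm_num)]
    refine ENNReal.ofReal_le_ofReal (pow_le_pow_left₀ (inv_nonneg.2 (by linarith)) ?_ d)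
    rw [inv_le_comm₀ (by linarith) (by norm_num)]
    linarith
  refine (ENNReal.pow_le_pow_left_iff two_ne_zero).1 ?_
  rw [mul_pow, eLpNorm_two_sq, eLpNorm_two_sq]
  refine h.trans_le ?_
  gcongr
  -- The sharp factor is at most `2 ^ (d / 2)`; the cruder `2 ^ d` avoids a square root.
  exact hle.trans (le_self_pow (one_le_pow₀ (by norm_num)) two_ne_zero)

/-- Density of compactly supported continuous functions reduces this to uniform continuity, since a
contraction moves points of `T` by at most `s * h`. Uniformity in `y` is what allows averaging over
`y` afterwards. -/
theorem exists_eLpNorm_comp_contraction_sub_le [NormedSpace ℝ F] {T : Set (Space d)} {h : ℝ}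
    (hdiam : ∀ x ∈ T, ∀ y ∈ T, dist x y ≤ h) (hTm : MeasurableSet T) (hTfin : volume T ≠ ⊤)
    {f : Space d → F} (hf : StronglyMeasurable f) (hf2 : MemLp f 2 volume)
    {ε : ENNReal} (hε : 0 < ε) :
    ∃ δ > 0, ∀ s : ℝ, 0 < s → s < δ → s ≤ 1 / 2 → ∀ y ∈ T,
      eLpNorm (fun x => f ((1 - s) • x + s • y) - f x) 2 (volume.restrict T) ≤ ε := by
  rcases eq_or_ne ε ⊤ with rfl | hεtop
  · exact ⟨1, one_pos, fun _ _ _ _ _ _ => le_top⟩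
  -- The approximation error is paid twice: composed with the contraction (factor `2 ^ d`) and
  -- directly (factor 1).
  set K : ENNReal := 2 ^ d + 1 with hK
  have hKtop : K ≠ ⊤ := by rw [hK]; finiteness
  have hK0 : K ≠ 0 := by simp [hK]
  obtain ⟨g, hgs, hfg, hgc, hg2⟩ := hf2.exists_hasCompactSupport_eLpNorm_sub_le
    ENNReal.ofNat_ne_top (ε := ε / 2 / K)
    (ENNReal.div_ne_zero.2 ⟨(ENNReal.half_pos hε.ne').ne', hKtop⟩)
  have hgu : UniformContinuous g := hgs.uniformContinuous_of_continuous hgc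
  -- The norm of the constant 1 on `T`, increased by 1 so that it can be divided by.
  set M : ENNReal := volume T ^ (1 / 2 : ℝ) + 1 with hM
  have hMtop : M ≠ ⊤ := by rw [hM]; finiteness
  have hM0 : M ≠ 0 := by simp [hM]
  obtain ⟨η, hη, hηε⟩ : ∃ η : ℝ, 0 < η ∧ M * ENNReal.ofReal η ≤ ε / 2 := by
    have h2 : ε / 2 / M ≠ 0 := ENNReal.div_ne_zero.2 ⟨(ENNReal.half_pos hε.ne').ne', hMtop⟩
    have h3 : ε / 2 / M ≠ ⊤ := ENNReal.div_ne_top (by finiteness) hM0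
    refine ⟨(ε / 2 / M).toReal, ENNReal.toReal_pos h2 h3, ?_⟩
    rw [ENNReal.ofReal_toReal h3, ENNReal.mul_div_cancel hM0 hMtop]
  obtain ⟨δ, hδ, hgδ⟩ := Metric.uniformContinuous_iff.1 hgu η hη
  refine ⟨δ / (|h| + 1), by positivity, fun s hs hsδ hs1 y hy => ?_⟩
  have hgm : StronglyMeasurable g := hgc.stronglyMeasurable
  have hθ : Continuous fun x : Space d => (1 - s) • x + s • y := by fun_prop
  have e1 : eLpNorm (fun x => (f - g) ((1 - s) • x + s • y)) 2 (volume.restrict T) ≤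
      2 ^ d * (ε / 2 / K) :=
    (eLpNorm_mono_measure _ Measure.restrict_le_self).trans
      ((eLpNorm_comp_contraction_le (hf.sub hgm) hs1 y).trans (by gcongr))
  have e2 : eLpNorm (fun x => g ((1 - s) • x + s • y) - g x) 2 (volume.restrict T) ≤ ε / 2 := by
    have hb : ∀ᵐ x ∂(volume.restrict T), ‖g ((1 - s) • x + s • y) - g x‖ ≤ η := by
      refine (ae_restrict_mem hTm).mono fun x hx => ?_
      rw [← dist_eq_norm]
      refine (hgδ ?_).le
      rw [dist_eq_norm, show (1 - s) • x + s • y - x = s • (y - x) by module, norm_smul,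
        Real.norm_of_nonneg hs.le, ← dist_eq_norm]
      have h4 : dist y x ≤ |h| := (hdiam y hy x hx).trans (le_abs_self h)
      rw [lt_div_iff₀ (by positivity)] at hsδ
      nlinarith [mul_le_mul_of_nonneg_left h4 hs.le]
    refine (eLpNorm_le_of_ae_bound hb).trans (le_trans ?_ hηε)
    rw [Measure.restrict_apply_univ]
    gcongr
    rw [hM]
    refine le_trans (le_of_eq ?_) le_self_add
    norm_num
  have e3 : eLpNorm (g - f) 2 (volume.restrict T) ≤ ε / 2 / K := by
    rw [← neg_sub, eLpNorm_neg]
    exact (eLpNorm_mono_measure _ Measure.restrict_le_self).trans hfg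
  have hdec : (fun x => f ((1 - s) • x + s • y) - f x) =
      (fun x => (f - g) ((1 - s) • x + s • y)) + (fun x => g ((1 - s) • x + s • y) - g x)
        + (g - f) := by
    ext x
    simp
  have m1 : AEStronglyMeasurable (fun x => (f - g) ((1 - s) • x + s • y)) (volume.restrict T) :=
    ((hf.sub hgm).comp_measurable hθ.measurable).aestronglyMeasurable
  have m2 : AEStronglyMeasurable (fun x => g ((1 - s) • x + s • y) - g x) (volume.restrict T) :=
    ((hgm.comp_measurable hθ.measurable).sub hgm).aestronglyMeasurable
  rw [hdec]
  calc _ ≤ eLpNorm (fun x => (f - g) ((1 - s) • x + s • y)) 2 (volume.restrict T) +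
        eLpNorm (fun x => g ((1 - s) • x + s • y) - g x) 2 (volume.restrict T) +
        eLpNorm (g - f) 2 (volume.restrict T) :=
        (eLpNorm_add_le (m1.add m2) (hgm.sub hf).aestronglyMeasurable one_le_two).trans
          (by gcongr; exact eLpNorm_add_le m1 m2 one_le_two)
    _ ≤ 2 ^ d * (ε / 2 / K) + ε / 2 + ε / 2 / K := by gcongr
    _ = K * (ε / 2 / K) + ε / 2 := by rw [hK]; ring
    _ = ε := by rw [ENNReal.mul_div_cancel hK0 hKtop, ENNReal.add_halves]

theorem enorm_contractionMean_sub_sq_le [NormedSpace ℝ F] [CompleteSpace F]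
    {ν : Measure (Space d)} [IsProbabilityMeasure ν] {f : Space d → F} (hf : StronglyMeasurable f)
    (s : ℝ) (x : Space d) :
    ‖contractionMean ν s f x - f x‖ₑ ^ 2 ≤ ∫⁻ y, ‖f ((1 - s) • x + s • y) - f x‖ₑ ^ 2 ∂ν := by
  have hm : StronglyMeasurable fun y => f ((1 - s) • x + s • y) :=
    hf.comp_measurable (by fun_prop)
  have hm' : StronglyMeasurable fun y => f ((1 - s) • x + s • y) - f x :=
    hm.sub stronglyMeasurable_const
  refine le_trans ?_ (sq_lintegral_le_lintegral_sq (by simp) hm'.enorm.aemeasurable)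
  gcongr
  by_cases hi : Integrable (fun y => f ((1 - s) • x + s • y)) ν
  · rw [contractionMean]
    have h1 : ∫ y, f ((1 - s) • x + s • y) ∂ν - f x =
        ∫ y, (f ((1 - s) • x + s • y) - f x) ∂ν := by
      rw [integral_sub hi (integrable_const _)]
      simp
    rw [h1]
    exact enorm_integral_le_lintegral_enorm _
  -- Here the Bochner mean takes its default value 0, but the right-hand side is infinite.
  · have h2 : ¬ Integrable (fun y => f ((1 - s) • x + s • y) - f x) ν := fun h3 =>
      hi ((h3.add (integrable_const (f x))).congr (by filter_upwards with y; simp))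
    have h4 : ∫⁻ y, ‖f ((1 - s) • x + s • y) - f x‖ₑ ∂ν = ⊤ := by
      by_contra h5
      exact h2 ⟨hm'.aestronglyMeasurable, lt_top_iff_ne_top.2 h5⟩
    rw [h4]
    exact le_top

/-- As the ratio tends to zero, the means over contractions converge in `L²`. -/
theorem tendsto_eLpNorm_contractionMean_sub [NormedSpace ℝ F] [CompleteSpace F]
    {T : Set (Space d)} {h : ℝ} (hdiam : ∀ x ∈ T, ∀ y ∈ T, dist x y ≤ h)
    (hTm : MeasurableSet T) (hTfin : volume T ≠ ⊤)
    {ν : Measure (Space d)} [IsProbabilityMeasure ν] (hν : ∀ᵐ y ∂ν, y ∈ T)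
    {f : Space d → F} (hf : StronglyMeasurable f) (hf2 : MemLp f 2 volume)
    {s : ℕ → ℝ} (hs : ∀ k, 0 < s k) (hs0 : Tendsto s atTop (𝓝 0)) :
    Tendsto (fun k => eLpNorm (contractionMean ν (s k) f - f) 2 (volume.restrict T))
      atTop (𝓝 0) := by
  rw [ENNReal.tendsto_nhds_zero]
  intro ε hε
  obtain ⟨δ, hδ, hb⟩ := exists_eLpNorm_comp_contraction_sub_le hdiam hTm hTfin hf hf2 hε
  have hev : ∀ᶠ k in atTop, s k < δ ∧ s k < 1 / 2 :=
    (hs0.eventually_lt_const hδ).and (hs0.eventually_lt_const (by norm_num))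
  filter_upwards [hev] with k hk
  have hmeas : Measurable (Function.uncurry fun x y : Space d =>
      ‖f ((1 - s k) • x + s k • y) - f x‖ₑ ^ 2) := by
    refine Measurable.pow_const (StronglyMeasurable.enorm ?_) 2
    refine (hf.comp_measurable (g := fun p : Space d × Space d =>
      (1 - s k) • p.1 + s k • p.2) (by fun_prop)).sub (hf.comp_measurable measurable_fst)
  refine (ENNReal.pow_le_pow_left_iff two_ne_zero).1 ?_
  rw [eLpNorm_two_sq]
  calc ∫⁻ x in T, ‖(contractionMean ν (s k) f - f) x‖ₑ ^ 2
      ≤ ∫⁻ x in T, ∫⁻ y, ‖f ((1 - s k) • x + s k • y) - f x‖ₑ ^ 2 ∂ν :=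
        lintegral_mono fun x => enorm_contractionMean_sub_sq_le hf (s k) x
    _ = ∫⁻ y, ∫⁻ x in T, ‖f ((1 - s k) • x + s k • y) - f x‖ₑ ^ 2 ∂volume ∂ν :=
        lintegral_lintegral_swap hmeas.aemeasurable
    _ ≤ ∫⁻ y, ε ^ 2 ∂ν := by
        refine lintegral_mono_ae (hν.mono fun y hy => ?_)
        rw [← eLpNorm_two_sq (fun x => f ((1 - s k) • x + s k • y) - f x)]
        gcongr
        exact hb (s k) (hs k) hk.1 hk.2.le y hy
    _ = ε ^ 2 := by simp

end CutTrace

/-! ### Smoothness and gradient of the means -/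

namespace CutTrace

variable {d : ℕ} {F : Type*} [NormedAddCommGroup F] [NormedSpace ℝ F]

/-- Substituting `z = (1 - s) • x + s • y` moves all dependence on `x` into the weight, so that `f`
need not be differentiable. -/
theorem contractionMean_withDensity {η : Space d → ℝ} (hη : Continuous η) (hη0 : ∀ y, 0 ≤ η y)
    {s : ℝ} (hs : 0 < s) (f : Space d → F) (x : Space d) :
    contractionMean (volume.withDensity fun y => ENNReal.ofReal (η y)) s f x =
      (s ^ d)⁻¹ • ∫ z, η (s⁻¹ • (z - (1 - s) • x)) • f z := by
  have h1 : ∫ y, f ((1 - s) • x + s • y) ∂(volume.withDensity fun y => ENNReal.ofReal (η y)) =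
      ∫ y, η y • f ((1 - s) • x + s • y) := by
    have h2 := integral_withDensity_eq_integral_smul (μ := (volume : Measure (Space d)))
      (f := fun y => (η y).toNNReal) hη.measurable.real_toNNReal
      (fun y => f ((1 - s) • x + s • y))
    refine h2.trans (integral_congr_ae (Eventually.of_forall fun y => ?_))
    simp only [NNReal.smul_def, Real.coe_toNNReal _ (hη0 y)]
  rw [contractionMean, h1]
  set G : Space d → F := fun z => η (s⁻¹ • (z - (1 - s) • x)) • f z with hG
  have h3 : ∀ y, η y • f ((1 - s) • x + s • y) = G (s • y + (1 - s) • x) := by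
    intro y
    simp only [hG, add_sub_cancel_right, smul_smul, inv_mul_cancel₀ hs.ne', one_smul]
    rw [add_comm]
  simp_rw [h3]
  rw [Measure.integral_comp_smul volume (fun z => G (z + (1 - s) • x)) s,
    integral_add_right_eq_self (fun z => G z), finrank_euclideanSpace_fin,
    abs_of_pos (by positivity)]

open scoped Convolution in
/-- Means of an integrable function over contractions, with a smooth weight, are smooth, and their
derivatives are obtained by differentiation under the integral sign. -/
theorem contDiff_contractionMean {η : Space d → ℝ} (hη : ContDiff ℝ ∞ η) (hη0 : ∀ y, 0 ≤ η y)
    (hηc : HasCompactSupport η) {s : ℝ} (hs : 0 < s) {w : Space d → ℝ}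
    (hw : LocallyIntegrable w) :
    ContDiff ℝ ∞ (contractionMean (volume.withDensity fun y => ENNReal.ofReal (η y)) s w) ∧
    ∀ x e, fderiv ℝ (contractionMean (volume.withDensity fun y => ENNReal.ofReal (η y)) s w) x e =
      -((1 - s) * ((s ^ d)⁻¹ *
        ∫ z, w z * fderiv ℝ (fun z => η (s⁻¹ • (z - (1 - s) • x))) z e)) := by
  -- Reflected so that the weight reads `k ((1 - s) • x - z)`: the mean is a convolution evaluated
  -- at `(1 - s) • x`.
  set k : Space d → ℝ := fun u => η (-(s⁻¹ • u)) with hk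
  have hkd : ContDiff ℝ ∞ k := by fun_prop
  have hkc : HasCompactSupport k := by
    have := hηc.comp_homeomorph ((Homeomorph.smulOfNeZero (-s⁻¹) (by simpa using hs.ne')))
    convert this using 1
    ext u
    simp [hk]
  have hform : contractionMean (volume.withDensity fun y => ENNReal.ofReal (η y)) s w =
      fun x => (s ^ d)⁻¹ • (w ⋆[ContinuousLinearMap.mul ℝ ℝ, volume] k) ((1 - s) • x) := by
    ext x
    rw [contractionMean_withDensity hη.continuous hη0 hs, convolution_def]
    congr 2
    ext z
    simp only [hk, ContinuousLinearMap.mul_apply', smul_eq_mul]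
    rw [mul_comm, ← smul_neg, neg_sub]
  have hconv : ContDiff ℝ ∞ (w ⋆[ContinuousLinearMap.mul ℝ ℝ, volume] k) :=
    hkc.contDiff_convolution_right _ hw hkd
  refine ⟨by rw [hform]; fun_prop, fun x e => ?_⟩
  have hk1 : ContDiff ℝ 1 k := hkd.of_le (by norm_cast)
  have hder := hkc.hasFDerivAt_convolution_right (ContinuousLinearMap.mul ℝ ℝ) hw hk1 ((1 - s) • x)
  have hlin : HasFDerivAt (fun x : Space d => (1 - s) • x)
      ((1 - s) • ContinuousLinearMap.id ℝ (Space d)) x :=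
    (hasFDerivAt_id x).const_smul (1 - s)
  have hcomp := (hder.comp x hlin).const_smul ((s ^ d)⁻¹)
  have hfd : fderiv ℝ (contractionMean (volume.withDensity fun y => ENNReal.ofReal (η y)) s w) x =
      (s ^ d)⁻¹ • ((w ⋆[(ContinuousLinearMap.mul ℝ ℝ).precompR (Space d), volume]
        fderiv ℝ k) ((1 - s) • x)).comp ((1 - s) • ContinuousLinearMap.id ℝ (Space d)) := by
    rw [hform]
    exact hcomp.fderiv
  -- The weight depends only on `(1 - s) • x - z`, so an `x`-derivative becomes a `z`-derivative
  -- with opposite sign, ready for the weak gradient.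
  have hχ : ∀ z, fderiv ℝ (fun z => η (s⁻¹ • (z - (1 - s) • x))) z e =
      - fderiv ℝ k ((1 - s) • x - z) e := by
    intro z
    have h1 : (fun z => η (s⁻¹ • (z - (1 - s) • x))) = fun z => k ((1 - s) • x - z) := by
      ext z
      simp only [hk]
      rw [← smul_neg, neg_sub]
    have h2 : HasFDerivAt (fun z : Space d => (1 - s) • x - z)
        (-ContinuousLinearMap.id ℝ (Space d)) z := (hasFDerivAt_id z).const_sub _
    have h3 := ((hk1.differentiable one_ne_zero).differentiableAt
      (x := (1 - s) • x - z)).hasFDerivAt.comp z h2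
    rw [h1, show (fun z => k ((1 - s) • x - z)) = k ∘ (fun z : Space d => (1 - s) • x - z) from rfl,
      h3.fderiv]
    simp
  rw [hfd]
  simp only [FunLike.coe_smul, Pi.smul_apply, ContinuousLinearMap.comp_apply,
    ContinuousLinearMap.id_apply, map_smul, smul_eq_mul]
  rw [convolution_precompR_apply _ hw (hkc.fderiv ℝ) (hk1.continuous_fderiv one_ne_zero),
    convolution_def]
  simp_rw [hχ, ContinuousLinearMap.mul_apply', mul_neg, integral_neg]
  ring

/-- On a convex open set, the gradient of the mean of a function over contractions is, up to a
factor, the mean of its weak gradient. -/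
theorem gradient_contractionMean {T : Set (Space d)} (hTc : Convex ℝ T) (hTo : IsOpen T)
    {η : Space d → ℝ} (hη : ContDiff ℝ ∞ η) (hη0 : ∀ y, 0 ≤ η y)
    (hηc : HasCompactSupport η) (hηT : tsupport η ⊆ T) {s : ℝ} (hs : 0 < s) (hs1 : s < 1)
    {w : Space d → ℝ} {G : Space d → Space d}
    (hw : LocallyIntegrable (T.indicator w)) (hG : LocallyIntegrable (T.indicator G))
    (hibp : ∀ φ : Space d → ℝ, ContDiff ℝ ∞ φ → HasCompactSupport φ → tsupport φ ⊆ T →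
      ∀ e : Space d, ∫ x in T, w x * fderiv ℝ φ x e = - ∫ x in T, ⟪G x, e⟫_ℝ * φ x)
    {x : Space d} (hx : x ∈ T) :
    gradient (contractionMean (volume.withDensity fun y => ENNReal.ofReal (η y)) s
        (T.indicator w)) x =
      (1 - s) • contractionMean (volume.withDensity fun y => ENNReal.ofReal (η y)) s
        (T.indicator G) x := by
  have hTm := hTo.measurableSet
  refine ext_inner_right ℝ fun e => ?_
  rw [gradient, InnerProductSpace.toDual_symm_apply,
    (contDiff_contractionMean hη hη0 hηc hs hw).2,
    contractionMean_withDensity hη.continuous hη0 hs]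
  set χ : Space d → ℝ := fun z => η (s⁻¹ • (z - (1 - s) • x)) with hχ
  have hχd : ContDiff ℝ ∞ χ := by fun_prop
  let H : Space d ≃ₜ Space d := (Homeomorph.subRight ((1 - s) • x)).trans
    (Homeomorph.smulOfNeZero s⁻¹ (inv_ne_zero hs.ne'))
  have hχH : χ = η ∘ H := rfl
  have hχc : HasCompactSupport χ := by
    rw [hχH]
    exact hηc.comp_homeomorph H
  -- The support is `(1 - s) • x + s • tsupport η`, inside `T` by convexity. Hence `χ` is an
  -- admissible test function.
  have hχT : tsupport χ ⊆ T := by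
    rw [hχH, tsupport_comp_eq_preimage]
    intro z hz
    have h1 : s⁻¹ • (z - (1 - s) • x) ∈ T := hηT hz
    have h2 : z = (1 - s) • x + s • (s⁻¹ • (z - (1 - s) • x)) := by
      rw [smul_smul, mul_inv_cancel₀ hs.ne', one_smul]
      abel
    rw [h2]
    exact hTc hx h1 (by linarith) hs.le (by ring)
  have h4 : ∫ z, T.indicator w z * fderiv ℝ χ z e = ∫ z in T, w z * fderiv ℝ χ z e := by
    rw [← integral_indicator hTm]
    congr 1
    ext z
    by_cases hz : z ∈ T <;> simp [hz]
  have h5 : ∫ z in T, ⟪G z, e⟫_ℝ * χ z = ⟪∫ z, χ z • T.indicator G z, e⟫_ℝ := by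
    rw [real_inner_comm, ← integral_inner, ← integral_indicator hTm]
    · congr 1
      ext z
      by_cases hz : z ∈ T <;> simp [hz, inner_smul_right, real_inner_comm, mul_comm]
    · exact hG.integrable_smul_left_of_hasCompactSupport hχd.continuous hχc
  rw [h4, hibp χ hχd hχc hχT e, h5, inner_smul_left, inner_smul_left]
  simp only [conj_trivial, mul_neg, neg_neg, hχ]

end CutTrace

/-! ### Density of smooth functions and extension to H¹ -/

namespace CutTrace

variable {d : ℕ}

theorem memLp_restrict_of_continuous {F : Type*} [NormedAddCommGroup F] {f : Space d → F}
    (hf : Continuous f) {T : Set (Space d)} (hT : Bornology.IsBounded T) {p : ENNReal} :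
    MemLp f p (volume.restrict T) := by
  have hc : IsCompact (closure T) := hT.isCompact_closure
  have : IsFiniteMeasure (volume.restrict T) := ⟨by simpa using hT.measure_lt_top⟩
  obtain ⟨C, hC⟩ := hc.exists_bound_of_continuousOn hf.continuousOn
  refine MemLp.of_bound hf.aestronglyMeasurable C ?_
  exact ae_restrict_of_ae_restrict_of_subset subset_closure
    ((ae_restrict_mem isClosed_closure.measurableSet).mono hC)

theorem norm_gradient {E : Type*} [NormedAddCommGroup E] [InnerProductSpace ℝ E] [CompleteSpace E]
    (f : E → ℝ) (x : E) : ‖gradient f x‖ = ‖fderiv ℝ f x‖ :=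
  LinearIsometryEquiv.norm_map _ _

theorem continuous_gradient {φ : Space d → ℝ} (hφ : ContDiff ℝ ∞ φ) : Continuous (gradient φ) :=
  (InnerProductSpace.toDual ℝ (Space d)).symm.continuous.comp (hφ.continuous_fderiv (by simp))

theorem gradient_sub_of_contDiff {φ ψ : Space d → ℝ} (hφ : ContDiff ℝ ∞ φ) (hψ : ContDiff ℝ ∞ ψ) :
    gradient (φ - ψ) = gradient φ - gradient ψ := by
  ext1 x
  simp only [gradient, Pi.sub_apply]
  rw [fderiv_sub (hφ.differentiable (by simp)).differentiableAt
    (hψ.differentiable (by simp)).differentiableAt, map_sub]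

/-- Smooth functions are dense in `H¹` of a bounded convex open set. -/
theorem exists_contDiff_tendsto_H1 {T : Set (Space d)} (hTc : Convex ℝ T) (hTo : IsOpen T)
    (hTb : Bornology.IsBounded T) (hTn : T.Nonempty) (v : H1 T) :
    ∃ φ : ℕ → Space d → ℝ, (∀ k, ContDiff ℝ ∞ (φ k)) ∧
      Tendsto (fun k => eLpNorm (φ k - v.val) 2 (volume.restrict T)) atTop (𝓝 0) ∧
      Tendsto (fun k => eLpNorm (gradient (φ k) - v.grad) 2 (volume.restrict T)) atTop (𝓝 0) := by
  have hTm := hTo.measurableSet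
  have hTfin : volume T ≠ ⊤ := hTb.measure_lt_top.ne
  have hdiam : ∀ x ∈ T, ∀ y ∈ T, dist x y ≤ Metric.diam T := fun x hx y hy =>
    Metric.dist_le_diam_of_mem hTb hx hy
  obtain ⟨c, hc⟩ := hTn
  obtain ⟨ρ, hρ, hρT⟩ := Metric.isOpen_iff.1 hTo c hc
  let b : ContDiffBump c := ⟨ρ / 4, ρ / 2, by positivity, by linarith⟩
  set η : Space d → ℝ := b.normed volume with hη
  have hηd : ContDiff ℝ ∞ η := b.contDiff_normed
  have hη0 : ∀ y, 0 ≤ η y := b.nonneg_normed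
  have hηc : HasCompactSupport η := b.hasCompactSupport_normed
  have hηT : tsupport η ⊆ T := by
    rw [hη, b.tsupport_normed_eq]
    exact (Metric.closedBall_subset_ball (by change ρ / 2 < ρ; linarith)).trans hρT
  set ν : Measure (Space d) := volume.withDensity fun y => ENNReal.ofReal (η y) with hν
  have hνp : IsProbabilityMeasure ν := by
    refine ⟨?_⟩
    rw [hν, withDensity_apply _ MeasurableSet.univ, Measure.restrict_univ,
      ← ofReal_integral_eq_lintegral_ofReal b.integrable_normed (Eventually.of_forall hη0),
      b.integral_normed, ENNReal.ofReal_one]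
  have hνT : ∀ᵐ y ∂ν, y ∈ T := by
    rw [hν, ae_withDensity_iff (f := fun y => ENNReal.ofReal (η y))
      (ENNReal.measurable_ofReal.comp hηd.continuous.measurable)]
    refine Eventually.of_forall fun y hy => hηT (subset_tsupport _ ?_)
    rw [Function.mem_support]
    rintro h0
    simp [h0] at hy
  -- Strongly measurable representatives, extended by zero, since the means evaluate the function at
  -- every point.
  set v₀ := v.memLp_val.1.mk with hv₀
  set G₀ := v.memLp_grad.1.mk with hG₀
  have hv₀e : v.val =ᵐ[volume.restrict T] v₀ := v.memLp_val.1.ae_eq_mk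
  have hG₀e : v.grad =ᵐ[volume.restrict T] G₀ := v.memLp_grad.1.ae_eq_mk
  have hw2 : MemLp (T.indicator v₀) 2 volume :=
    (memLp_indicator_iff_restrict hTm).2 (v.memLp_val.ae_eq hv₀e)
  have hG2 : MemLp (T.indicator G₀) 2 volume :=
    (memLp_indicator_iff_restrict hTm).2 (v.memLp_grad.ae_eq hG₀e)
  have hws : StronglyMeasurable (T.indicator v₀) :=
    v.memLp_val.1.stronglyMeasurable_mk.indicator hTm
  have hGs : StronglyMeasurable (T.indicator G₀) :=
    v.memLp_grad.1.stronglyMeasurable_mk.indicator hTm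
  have hwe : v.val =ᵐ[volume.restrict T] T.indicator v₀ :=
    hv₀e.trans (indicator_ae_eq_restrict hTm).symm
  have hGe : v.grad =ᵐ[volume.restrict T] T.indicator G₀ :=
    hG₀e.trans (indicator_ae_eq_restrict hTm).symm
  have hibp : ∀ φ : Space d → ℝ, ContDiff ℝ ∞ φ → HasCompactSupport φ → tsupport φ ⊆ T →
      ∀ e : Space d, ∫ x in T, v₀ x * fderiv ℝ φ x e = - ∫ x in T, ⟪G₀ x, e⟫_ℝ * φ x := by
    intro φ h1 h2 h3 e
    have h4 : ∫ x in T, v₀ x * fderiv ℝ φ x e = ∫ x in T, v.val x * fderiv ℝ φ x e :=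
      integral_congr_ae (hv₀e.mono fun x hx => by simp only [hx])
    have h5 : ∫ x in T, ⟪G₀ x, e⟫_ℝ * φ x = ∫ x in T, ⟪v.grad x, e⟫_ℝ * φ x :=
      integral_congr_ae (hG₀e.mono fun x hx => by simp only [hx])
    rw [h4, h5, v.integral_by_parts φ h1 h2 h3 e]
  have hwl := hw2.locallyIntegrable one_le_two
  have hGl := hG2.locallyIntegrable one_le_two
  -- The shift by 2 keeps `s 0 < 1`, as the gradient formula requires.
  set s : ℕ → ℝ := fun k => 1 / ((k : ℝ) + 2) with hsdef
  have hs : ∀ k, 0 < s k := fun k => by positivity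
  have hs1 : ∀ k, s k < 1 := fun k => by
    rw [hsdef, div_lt_one (by positivity)]
    linarith [(Nat.cast_nonneg k : (0 : ℝ) ≤ k)]
  have hs0 : Tendsto s atTop (𝓝 0) :=
    Tendsto.const_div_atTop (tendsto_atTop_add_const_right _ _ tendsto_natCast_atTop_atTop) 1
  have hlim := tendsto_eLpNorm_contractionMean_sub hdiam hTm hTfin hνT hws hw2 hs hs0
  have hlimG := tendsto_eLpNorm_contractionMean_sub hdiam hTm hTfin hνT hGs hG2 hs hs0
  refine ⟨fun k => contractionMean ν (s k) (T.indicator v₀), fun k =>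
    (contDiff_contractionMean hηd hη0 hηc (hs k) hwl).1, ?_, ?_⟩
  · refine hlim.congr fun k => ?_
    exact eLpNorm_congr_ae (EventuallyEq.rfl.sub hwe.symm)
  -- On `T` the gradient error is `(1 - s) • (Φ - G₀) - s • G₀`, where `Φ` is the mean of `G₀`; both
  -- terms tend to zero.
  · have hup : Tendsto (fun k => eLpNorm (contractionMean ν (s k) (T.indicator G₀) -
        T.indicator G₀) 2 (volume.restrict T) + ENNReal.ofReal (s k) *
        eLpNorm (T.indicator G₀) 2 (volume.restrict T)) atTop (𝓝 0) := by
      have h1 : Tendsto (fun k => ENNReal.ofReal (s k) *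
          eLpNorm (T.indicator G₀) 2 (volume.restrict T)) atTop (𝓝 0) := by
        have h2 : Tendsto (fun k => ENNReal.ofReal (s k)) atTop (𝓝 0) := by
          simpa using ENNReal.tendsto_ofReal hs0
        simpa using ENNReal.Tendsto.mul_const h2
          (Or.inr (hG2.mono_measure Measure.restrict_le_self).2.ne)
      simpa using hlimG.add h1
    refine tendsto_of_tendsto_of_tendsto_of_le_of_le tendsto_const_nhds hup
      (fun _ => zero_le) fun k => ?_
    set Φ := contractionMean ν (s k) (T.indicator G₀) with hΦ
    have hgrad : ∀ x ∈ T, gradient (contractionMean ν (s k) (T.indicator v₀)) x =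
        (1 - s k) • Φ x := fun x hx =>
      gradient_contractionMean hTc hTo hηd hη0 hηc hηT (hs k) (hs1 k) hwl hGl hibp hx
    have hΦm : AEStronglyMeasurable Φ (volume.restrict T) := by
      have h3 : AEStronglyMeasurable (gradient (contractionMean ν (s k) (T.indicator v₀)))
          (volume.restrict T) :=
        (continuous_gradient (contDiff_contractionMean hηd hη0 hηc (hs k) hwl).1
          ).aestronglyMeasurable
      refine (h3.const_smul ((1 - s k)⁻¹)).congr ((ae_restrict_mem hTm).mono fun x hx => ?_)
      rw [Pi.smul_apply, hgrad x hx, smul_smul, inv_mul_cancel₀ (by linarith [hs1 k]), one_smul]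
    have hle : eLpNorm (gradient (contractionMean ν (s k) (T.indicator v₀)) - v.grad) 2
        (volume.restrict T) = eLpNorm ((1 - s k) • (Φ - T.indicator G₀) +
          (-s k) • T.indicator G₀) 2 (volume.restrict T) := by
      refine eLpNorm_congr_ae ?_
      filter_upwards [ae_restrict_mem hTm, hGe] with x hx hGx
      rw [Pi.sub_apply, hgrad x hx, hGx]
      simp only [Pi.add_apply, Pi.smul_apply, Pi.sub_apply]
      module
    change eLpNorm (gradient (contractionMean ν (s k) (T.indicator v₀)) - v.grad) 2
        (volume.restrict T) ≤ _
    rw [hle]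
    refine (eLpNorm_add_le ((hΦm.sub hGs.aestronglyMeasurable).const_smul _)
      (hGs.aestronglyMeasurable.const_smul _) one_le_two).trans ?_
    rw [eLpNorm_const_smul, eLpNorm_const_smul]
    gcongr
    · refine mul_le_of_le_one_left' ?_
      rw [Real.enorm_eq_ofReal_abs, abs_of_pos (by linarith [hs1 k])]
      exact ENNReal.ofReal_le_one.2 (by linarith [hs k])
    · rw [enorm_neg, Real.enorm_eq_ofReal_abs, abs_of_pos (hs k)]

/-- A trace inequality for smooth functions extends to `H¹`. -/
theorem exists_isTrace_and_eLpNorm_le {T A : Set (Space d)} (hTc : Convex ℝ T) (hTo : IsOpen T)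
    (hTb : Bornology.IsBounded T) (hTn : T.Nonempty) {P Q : ENNReal} (hP : P ≠ ⊤) (hQ : Q ≠ ⊤)
    (hsm : ∀ φ : Space d → ℝ, ContDiff ℝ ∞ φ → eLpNorm φ 2 ((surface d).restrict A) ≤
      P * eLpNorm φ 2 (volume.restrict T) + Q * eLpNorm (gradient φ) 2 (volume.restrict T))
    (v : H1 T) :
    (∃ g, IsTrace v A g) ∧ ∀ g, IsTrace v A g → eLpNorm g 2 ((surface d).restrict A) ≤
      P * eLpNorm v.val 2 (volume.restrict T) + Q * eLpNorm v.grad 2 (volume.restrict T) := by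
  constructor
  · obtain ⟨φ, hφ, h1, h2⟩ := exists_contDiff_tendsto_H1 hTc hTo hTb hTn v
    have hLp : ∀ k, MemLp (φ k) 2 ((surface d).restrict A) := fun k => by
      refine ⟨(hφ k).continuous.aestronglyMeasurable, (hsm _ (hφ k)).trans_lt ?_⟩
      have h3 := (memLp_restrict_of_continuous (hφ k).continuous hTb (p := 2)).2.ne
      have h4 := (memLp_restrict_of_continuous (continuous_gradient (hφ k)) hTb (p := 2)).2.ne
      exact lt_top_iff_ne_top.2 (by finiteness)
    set a : ℕ → ENNReal := fun k => P * eLpNorm (φ k - v.val) 2 (volume.restrict T) +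
      Q * eLpNorm (gradient (φ k) - v.grad) 2 (volume.restrict T) with ha
    have ha0 : Tendsto a atTop (𝓝 0) := by
      have h3 := (ENNReal.Tendsto.const_mul h1 (Or.inr hP)).add
        (ENNReal.Tendsto.const_mul h2 (Or.inr hQ))
      simpa using h3
    have hsub : ∀ m n, eLpNorm (φ m - φ n) 2 ((surface d).restrict A) ≤ a m + a n := by
      intro m n
      refine (hsm (φ m - φ n) ((hφ m).sub (hφ n))).trans ?_
      have tri : ∀ {F : Type} [NormedAddCommGroup F] {f g u : Space d → F},
          AEStronglyMeasurable f (volume.restrict T) → AEStronglyMeasurable g (volume.restrict T) →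
          AEStronglyMeasurable u (volume.restrict T) →
          eLpNorm (f - g) 2 (volume.restrict T) ≤ eLpNorm (f - u) 2 (volume.restrict T) +
            eLpNorm (g - u) 2 (volume.restrict T) := by
        intro F _ f g u hf hg hu
        rw [← sub_sub_sub_cancel_right f g u]
        exact eLpNorm_sub_le (hf.sub hu) (hg.sub hu) one_le_two
      have h3 := tri (hφ m).continuous.aestronglyMeasurable
        (hφ n).continuous.aestronglyMeasurable v.memLp_val.1
      have h4 := tri (continuous_gradient (hφ m)).aestronglyMeasurable
        (continuous_gradient (hφ n)).aestronglyMeasurable v.memLp_grad.1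
      rw [gradient_sub_of_contDiff (hφ m) (hφ n)]
      calc _ ≤ P * (eLpNorm (φ m - v.val) 2 (volume.restrict T) +
            eLpNorm (φ n - v.val) 2 (volume.restrict T)) +
            Q * (eLpNorm (gradient (φ m) - v.grad) 2 (volume.restrict T) +
            eLpNorm (gradient (φ n) - v.grad) 2 (volume.restrict T)) := by gcongr
        _ = a m + a n := by rw [ha]; ring
    have hcau : CauchySeq fun k => (hLp k).toLp (φ k) := by
      rw [Lp.cauchySeq_Lp_iff_cauchySeq_eLpNorm]
      have h3 : Tendsto (fun p : ℕ × ℕ => a p.1 + a p.2) atTop (𝓝 0) := by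
        rw [← prod_atTop_atTop_eq]
        simpa using (ha0.comp tendsto_fst).add (ha0.comp tendsto_snd)
      refine tendsto_of_tendsto_of_tendsto_of_le_of_le tendsto_const_nhds h3
        (fun _ => zero_le) fun p => ?_
      refine le_trans (le_of_eq (eLpNorm_congr_ae ?_)) (hsub p.1 p.2)
      exact (hLp p.1).coeFn_toLp.sub (hLp p.2).coeFn_toLp
    obtain ⟨g, hg⟩ := cauchySeq_tendsto_of_complete hcau
    refine ⟨g, Lp.memLp g, φ, hφ, h1, h2, ?_⟩
    rw [Lp.tendsto_Lp_iff_tendsto_eLpNorm'] at hg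
    refine hg.congr fun k => eLpNorm_congr_ae ?_
    exact (hLp k).coeFn_toLp.sub EventuallyEq.rfl
  · rintro g ⟨hg, φ, hφ, h1, h2, h3⟩
    -- The bound passes to the limit along the sequence that witnesses the given trace, so
    -- uniqueness of traces is not needed.
    have hlim : Tendsto (fun k => eLpNorm (φ k - g) 2 ((surface d).restrict A) +
        (P * (eLpNorm (φ k - v.val) 2 (volume.restrict T) + eLpNorm v.val 2 (volume.restrict T)) +
        Q * (eLpNorm (gradient (φ k) - v.grad) 2 (volume.restrict T) +
          eLpNorm v.grad 2 (volume.restrict T)))) atTop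
        (𝓝 (0 + (P * (0 + eLpNorm v.val 2 (volume.restrict T)) +
          Q * (0 + eLpNorm v.grad 2 (volume.restrict T))))) :=
      h3.add ((ENNReal.Tendsto.const_mul (h1.add tendsto_const_nhds) (Or.inr hP)).add
        (ENNReal.Tendsto.const_mul (h2.add tendsto_const_nhds) (Or.inr hQ)))
    rw [zero_add, zero_add, zero_add] at hlim
    refine ge_of_tendsto' hlim fun k => ?_
    have tri : ∀ {F : Type} [NormedAddCommGroup F] {f u : Space d → F},
        AEStronglyMeasurable f (volume.restrict T) → AEStronglyMeasurable u (volume.restrict T) →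
        eLpNorm f 2 (volume.restrict T) ≤ eLpNorm (f - u) 2 (volume.restrict T) +
          eLpNorm u 2 (volume.restrict T) := by
      intro F _ f u hf hu
      simpa using eLpNorm_add_le (hf.sub hu) hu one_le_two
    have h4 := tri (hφ k).continuous.aestronglyMeasurable v.memLp_val.1
    have h5 := tri (continuous_gradient (hφ k)).aestronglyMeasurable v.memLp_grad.1
    have h6 : eLpNorm g 2 ((surface d).restrict A) ≤
        eLpNorm (φ k - g) 2 ((surface d).restrict A) +
          eLpNorm (φ k) 2 ((surface d).restrict A) := by
      have h7 := eLpNorm_sub_le (μ := (surface d).restrict A) (p := 2)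
        (hφ k).continuous.aestronglyMeasurable
        ((hφ k).continuous.aestronglyMeasurable.sub hg.1) one_le_two
      rw [sub_sub_cancel, add_comm] at h7
      exact h7
    refine h6.trans ?_
    gcongr
    refine (hsm _ (hφ k)).trans ?_
    gcongr

end CutTrace

/-! ### Scaling, shape regularity and the final assembly -/

namespace CutTrace

theorem diam_pos_of_isOpen {d : ℕ} (hd : 1 ≤ d) {T : Set (Space d)} (hTo : IsOpen T)
    (hTb : Bornology.IsBounded T) (hTn : T.Nonempty) : 0 < Metric.diam T := by
  have : Nontrivial (Space d) := by
    have : NeZero d := ⟨by omega⟩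
    infer_instance
  obtain ⟨c, hc⟩ := hTn
  exact Metric.diam_pos (infinite_of_mem_nhds c (hTo.mem_nhds hc)).nontrivial hTb

/-- The trace inequality for smooth functions on a convex open set of bounded chunkiness, with a
constant which depends only on the dimension, the chunkiness and the Ahlfors constant of the
measure. -/
theorem exists_eLpNorm_le_of_convex {d : ℕ} (hd : 1 ≤ d) {κ : ℝ} (hκ : 0 < κ) (A : NNReal) :
    ∃ C : ℝ, 0 < C ∧ ∀ (μ : Measure (Space d)) (_ : SFinite μ)
      (_ : ∀ z r, 0 ≤ r → μ (Metric.closedBall z r) ≤ A * ENNReal.ofReal (r ^ (d - 1)))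
      (T : Set (Space d)) (_ : Convex ℝ T) (_ : IsOpen T) (_ : Bornology.IsBounded T)
      (h : ℝ) (_ : h = Metric.diam T) (_ : 0 < h) (c : Space d) (_ : Metric.ball c (h / κ) ⊆ T)
      (φ : Space d → ℝ) (_ : ContDiff ℝ ∞ φ),
      eLpNorm φ 2 (μ.restrict T) ≤ ENNReal.ofReal C *
        (ENNReal.ofReal (h ^ (-(1 / 2) : ℝ)) * eLpNorm φ 2 (volume.restrict T) +
          ENNReal.ofReal (h ^ (1 / 2 : ℝ)) * eLpNorm (gradient φ) 2 (volume.restrict T)) := by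
  set V : ENNReal := volume (Metric.ball (0 : Space d) 1) with hV
  have hVtop : V ≠ ⊤ := measure_ball_lt_top.ne
  have hV0 : 0 < V.toReal :=
    ENNReal.toReal_pos (Metric.measure_ball_pos volume _ one_pos).ne' hVtop
  set K : ℝ := V.toReal * (κ ^ d)⁻¹ with hK
  have hK0 : 0 < K := by positivity
  -- Chosen so that `K * C ^ 2 ≥ 8 * A`, where `K * h ^ d` bounds the volume of `T` below; the added
  -- 1 keeps `C` positive when `A = 0`.
  set C : ℝ := Real.sqrt (8 * A / K) + 1 with hC
  have hC0 : 0 < C := by positivity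
  have hKC : 8 * (A : ℝ) ≤ K * C ^ 2 := by
    have h1 : 8 * A / K ≤ C ^ 2 := by
      calc 8 * A / K = Real.sqrt (8 * A / K) ^ 2 := (Real.sq_sqrt (by positivity)).symm
        _ ≤ C ^ 2 := by gcongr; linarith
    rwa [div_le_iff₀' hK0] at h1
  refine ⟨C, hC0, fun μ hμs hμ T hTc hTo hTb h hh hh0 c hcT φ hφ => ?_⟩
  have hmain := lintegral_sq_le_of_convex hTc hTo (h := h)
    (fun x hx y hy => hh ▸ Metric.dist_le_diam_of_mem hTb hx hy) hh0 hμ hd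
    (φ := φ) (hφ.of_le (by norm_cast))
  have hvol : ENNReal.ofReal (K * h ^ d) ≤ volume T := by
    refine le_trans (le_of_eq ?_) (measure_mono hcT)
    rw [Measure.addHaar_ball_of_pos _ _ (by positivity), finrank_euclideanSpace_fin, ← hV,
      ← ENNReal.ofReal_toReal hVtop, ← ENNReal.ofReal_mul (by positivity), hK]
    congr 1
    rw [div_pow]
    ring
  have hgr : ∀ y, ‖fderiv ℝ φ y‖ₑ = ‖gradient φ y‖ₑ := fun y => by
    rw [← ofReal_norm, ← ofReal_norm, norm_gradient]
  simp_rw [hgr, ← eLpNorm_two_sq] at hmain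
  set a := eLpNorm φ 2 (μ.restrict T) with ha
  set X := eLpNorm φ 2 (volume.restrict T) with hX
  set Y := eLpNorm (gradient φ) 2 (volume.restrict T) with hY
  set P := ENNReal.ofReal (h ^ (-(1 / 2) : ℝ)) with hP
  set Q := ENNReal.ofReal (h ^ (1 / 2 : ℝ)) with hQ
  have hP2 : ENNReal.ofReal (h ^ (d - 1)) = ENNReal.ofReal (h ^ d) * P ^ 2 := by
    rw [hP, ← ENNReal.ofReal_pow (by positivity), ← ENNReal.ofReal_mul (by positivity),
      ← Real.rpow_natCast (h ^ (-(1 / 2) : ℝ)), ← Real.rpow_mul hh0.le]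
    congr 1
    obtain ⟨m, rfl⟩ : ∃ m, d = m + 1 := ⟨d - 1, by omega⟩
    norm_num [Real.rpow_neg_one]
    field_simp
    rw [pow_succ]
  have hQ2 : ENNReal.ofReal (h ^ (d + 1)) = ENNReal.ofReal (h ^ d) * Q ^ 2 := by
    rw [hQ, ← ENNReal.ofReal_pow (by positivity), ← ENNReal.ofReal_mul (by positivity),
      ← Real.rpow_natCast (h ^ (1 / 2 : ℝ)), ← Real.rpow_mul hh0.le]
    norm_num [pow_succ]
  have hH0 : ENNReal.ofReal (h ^ d) ≠ 0 := by simpa using pow_pos hh0 d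
  -- Both sides keep the factor `h ^ d`, using `h ^ (d - 1) = h ^ d * P ^ 2` and `h ^ (d + 1) = h ^
  -- d * Q ^ 2`; it is cancelled at the end.
  have hfin : ENNReal.ofReal (h ^ d) * (ENNReal.ofReal K * a ^ 2) ≤
      ENNReal.ofReal (h ^ d) * (ENNReal.ofReal K * (ENNReal.ofReal C * (P * X + Q * Y)) ^ 2) := by
    calc ENNReal.ofReal (h ^ d) * (ENNReal.ofReal K * a ^ 2)
        = ENNReal.ofReal (K * h ^ d) * a ^ 2 := by
          rw [ENNReal.ofReal_mul hK0.le]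
          ring
      _ ≤ volume T * a ^ 2 := by gcongr
      _ ≤ _ := hmain
      _ = ENNReal.ofReal (h ^ d) * (A * (2 * (P * X) ^ 2 + 8 * (Q * Y) ^ 2)) := by
          rw [hP2, hQ2]
          ring
      _ ≤ ENNReal.ofReal (h ^ d) * (A * (8 * (P * X + Q * Y) ^ 2)) := by
          gcongr
          calc 2 * (P * X) ^ 2 + 8 * (Q * Y) ^ 2 ≤ 8 * (P * X) ^ 2 + 8 * (Q * Y) ^ 2 := by
                gcongr
                norm_num
            _ ≤ 8 * (P * X) ^ 2 + 8 * (Q * Y) ^ 2 + 16 * ((P * X) * (Q * Y)) := le_self_add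
            _ = _ := by ring
      _ = ENNReal.ofReal (h ^ d) * (ENNReal.ofReal (8 * A) * (P * X + Q * Y) ^ 2) := by
          rw [ENNReal.ofReal_mul (by norm_num), ENNReal.ofReal_coe_nnreal, ENNReal.ofReal_ofNat]
          ring
      _ ≤ ENNReal.ofReal (h ^ d) * (ENNReal.ofReal (K * C ^ 2) * (P * X + Q * Y) ^ 2) := by
          gcongr
      _ = _ := by
          rw [ENNReal.ofReal_mul hK0.le, ENNReal.ofReal_pow hC0.le]
          ring
  rw [ENNReal.mul_le_mul_iff_right hH0 ENNReal.ofReal_ne_top,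
    ENNReal.mul_le_mul_iff_right (by simpa using hK0) ENNReal.ofReal_ne_top] at hfin
  exact (ENNReal.pow_le_pow_left_iff two_ne_zero).1 hfin

end CutTrace

theorem mainTheorem6 (d : ℕ) (hd : d = 2 ∨ d = 3)
    (Ω : Set (CutTrace.Space d)) (hΩ : CutTrace.IsBoundedLipschitzDomain Ω)
    (κ : ℝ) (hκ : 0 < κ) (h₀ : ℝ) (hh₀ : 0 < h₀) :
    ∃ C : ℝ, 0 < C ∧
      ∀ (S : Set (CutTrace.Space d)) (K : Geometry.SimplicialComplex ℝ (CutTrace.Space d)),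
        Ω ⊆ S → CutTrace.IsTriangulation K S → CutTrace.IsShapeRegular κ K →
        CutTrace.meshSize K < h₀ →
        ∀ T ∈ CutTrace.cutElements K Ω, ∀ v : CutTrace.H1 T,
          (∃ g : CutTrace.Space d → ℝ, CutTrace.IsTrace v (T ∩ frontier Ω) g) ∧
          ∀ g : CutTrace.Space d → ℝ, CutTrace.IsTrace v (T ∩ frontier Ω) g →
            CutTrace.normL2 (CutTrace.surface d) (T ∩ frontier Ω) g ≤
              C * (Metric.diam T ^ (-(1 / 2) : ℝ) * CutTrace.normL2 volume T v.val
                + Metric.diam T ^ ((1 / 2) : ℝ) * CutTrace.normL2 volume T v.grad) := by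
  open CutTrace in
  have hd1 : 1 ≤ d := by omega
  obtain ⟨A, hA⟩ := hΩ.exists_surface_frontier_inter_closedBall_le
  obtain ⟨C, hC, hbound⟩ := exists_eLpNorm_le_of_convex hd1 hκ A
  refine ⟨C, hC, fun S K _ _ hreg _ T hT v => ?_⟩
  have hTreg := hreg T hT.1
  obtain ⟨hTc, hTo, hTb⟩ : Convex ℝ T ∧ IsOpen T ∧ Bornology.IsBounded T := by
    obtain ⟨s, -, -, rfl⟩ := hT.1
    exact ⟨(convex_convexHull ℝ _).interior, isOpen_interior,
      (isBounded_convexHull.2 s.finite_toSet.isBounded).subset interior_subset⟩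
  have hne : {r | ∃ c, Metric.ball c r ⊆ T}.Nonempty := ⟨0, 0, by simp⟩
  -- Strictness in the shape regularity yields an actual ball of radius above `h_T / κ`, whether or
  -- not the supremum is attained.
  obtain ⟨r, ⟨c, hcT⟩, hr⟩ := exists_lt_of_lt_csSup hne hTreg
  have hr0 : 0 < r := (div_nonneg Metric.diam_nonneg hκ.le).trans_lt hr
  have hTn : T.Nonempty := ⟨c, hcT (Metric.mem_ball_self hr0)⟩
  have hdiam : 0 < Metric.diam T := diam_pos_of_isOpen hd1 hTo hTb hTn
  have hΓm : MeasurableSet (frontier Ω) := isClosed_frontier.measurableSet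
  have hΓ : ∀ z r, 0 ≤ r → (surface d).restrict (frontier Ω) (Metric.closedBall z r) ≤
      A * ENNReal.ofReal (r ^ (d - 1)) := fun z r hr => by
    rw [Measure.restrict_apply measurableSet_closedBall, Set.inter_comm]
    exact hA z r hr
  -- Restricting to the bounded frontier makes the surface measure finite, which the interchange of
  -- integrals relies on.
  have hΓfin : IsFiniteMeasure ((surface d).restrict (frontier Ω)) := by
    obtain ⟨R, hR0, hR⟩ := (hΩ.isBounded.closure.subset
      frontier_subset_closure).subset_closedBall_lt 0 0
    refine ⟨?_⟩
    rw [Measure.restrict_apply_univ, ← Set.inter_eq_left.2 hR]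
    exact (hA 0 R hR0.le).trans_lt (lt_top_iff_ne_top.2 (by finiteness))
  have hsm := hbound _ (inferInstance : SFinite ((surface d).restrict (frontier Ω))) hΓ T hTc hTo
    hTb _ rfl hdiam c ((Metric.ball_subset_ball hr.le).trans hcT)
  rw [Measure.restrict_restrict hTo.measurableSet] at hsm
  simp_rw [mul_add, ← mul_assoc] at hsm
  obtain ⟨hex, hle⟩ := exists_isTrace_and_eLpNorm_le hTc hTo hTb hTn
    (by finiteness) (by finiteness) hsm v
  refine ⟨hex, fun g hg => ?_⟩
  have hX := v.memLp_val.2.ne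
  have hY := v.memLp_grad.2.ne
  -- Passing to real norms needs a finite right-hand side, which is the square integrability of `v`
  -- and its gradient.
  have h1 := ENNReal.toReal_mono (by finiteness) (hle g hg)
  rw [ENNReal.toReal_add (by finiteness) (by finiteness)] at h1
  simp only [ENNReal.toReal_mul, ENNReal.toReal_ofReal hC.le,
    ENNReal.toReal_ofReal (Real.rpow_nonneg hdiam.le _)] at h1
  rw [mul_add, ← mul_assoc, ← mul_assoc]
  exact h1
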